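/- Let $S$ be a scheduling problem on $n$ items, i.e. a boolean formula over atomic formulas $x_i\le x_j$, $i,j\in[n]$. A decision tree is either a leaf, i.e. a (finite, possibly empty) conjunction of inequalities of the form $x_i\le x_j$ or $x_i<x_j$, or an expression "if $\varphi$ then $\psi_t$ else $\psi_f$", where $\varphi$ is such an inequality and $\psi_t,\psi_f$ are decision trees. The cell of a leaf is the conjunction of the leaf with the conditions $\varphi$ (respectively $\neg\varphi$) of its ancestors in whose "then" (respectively "else") branch it lies, and with $0<x_i<1$ for all $i$; it is identified with its solution set in $\mathbb{R}^n$. A set $P\subseteq\mathbb{R}^n$ is almost open if it is the solution set of a finite conjunction of linear inequalities, weak or strict, which are all facet-defining for (the closure of) $P$ and of which at most one is weak. Suppose that $S$ is equivalent to a disjoint union (a disjunction in which, for every $x\in\mathbb{R}^n$, at most one member is true) of finitely many decision trees such that every non-empty cell of each of these trees is almost open. Then: 1. The scheduling quasisymmetric function $\sum_a x_{a_1}\cdots x_{a_n}$, in commuting variables $x_1,x_2,\dots$, where $a$ ranges over all vectors of positive integers that solve $S$, is $L$-positive: it is a linear combination with non-negative integer coefficients of the fundamental quasisymmetric functions $L_\alpha=\sum_{\beta\text{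 refines }\alpha}M_\beta$, where $\alpha,\beta$ are compositions of $n$ and $M_\beta=\sum_{i_1<\dots<i_\ell}x_{i_1}^{\beta_1}\cdots x_{i_\ell}^{\beta_\ell}$. 2. The scheduling polynomial is $h^*$-positive: there is a polynomial $\chi_S$ whose value at every integer $k\ge 0$ is the number of $a\in\{1,\dots,k\}^n$ that solve $S$, and $\chi_S(k)=\sum_{i=0}^n h^*_i\binom{k+n-i}{n}$ for all integers $k\ge 0$ with $h^*_0,\dots,h^*_n\ge 0$. -/

import Mathlib

noncomputable section

namespace Scheduling

open scoped Classical

/-! ### Scheduling problems -/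

/-- A scheduling problem on `n` items: a boolean formula over the atomic formulas `x i ≤ x j`. -/
inductive Problem (n : ℕ) : Type
  | falsum : Problem n
  | atom (i j : Fin n) : Problem n
  | not (S : Problem n) : Problem n
  | and (S T : Problem n) : Problem n
  | or (S T : Problem n) : Problem n

/-- `S.Holds x`: the formula `S` is true for the assignment `x`, with values in any linear order. -/
def Problem.Holds {n : ℕ} {α : Type*} [LinearOrder α] : Problem n → (Fin n → α) → Prop
  | .falsum, _ => False
  | .atom i j, x => x i ≤ x j
  | .not S, x => ¬ S.Holds x
  | .and S T, x => S.Holds x ∧ T.Holds x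
  | .or S T, x => S.Holds x ∨ T.Holds x

/-- The scheduling counting function: the number of `a ∈ [k]^n` that solve `S`. -/
def count {n : ℕ} (S : Problem n) (k : ℕ) : ℕ :=
  Nat.card {a : Fin n → Set.Icc 1 k // S.Holds a}

/-- `p` is the scheduling polynomial of `S`: its value at every `k` is the number of `k`-schedules.
Such a polynomial is unique. -/
def IsSchedulingPolynomial {n : ℕ} (S : Problem n) (p : Polynomial ℚ) : Prop :=
  ∀ k : ℕ, p.eval (k : ℚ) = (count S k : ℚ)

/-- `h` is the `h^*`-vector `(h 0, …, h n)` of the polynomial `p` (with respect to `n`):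
`p(k) = ∑_{i=0}^n h i * binom(k + n - i, n)`. The vector is determined by `p` and `n`. -/
def IsHStarVector (n : ℕ) (p : Polynomial ℚ) (h : Fin (n + 1) → ℚ) : Prop :=
  ∀ k : ℕ, p.eval (k : ℚ) = ∑ i : Fin (n + 1), h i * ((k + n - (i : ℕ)).choose n : ℚ)

/-- `p` is `h^*`-positive: its `h^*`-vector exists and has non-negative entries. -/
def HStarPositive (n : ℕ) (p : Polynomial ℚ) : Prop :=
  ∃ h : Fin (n + 1) → ℚ, IsHStarVector n p h ∧ ∀ i, 0 ≤ h i

/-! ### Quasisymmetric functions in the variables `x_1, x_2, …` -/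

/-- The scheduling quasisymmetric function of `S` in commuting variables,
`∑ x_{a 1} ⋯ x_{a n}` over all vectors `a` of positive integers that solve `S`. The coefficient of
a monomial is the number of solutions `a` that give this monomial. -/
def schedulingQSym {n : ℕ} (S : Problem n) : MvPowerSeries ℕ+ ℤ := fun m =>
  (Nat.card {a : Fin n → ℕ+ // S.Holds a ∧ ∑ i, Finsupp.single (a i) 1 = m} : ℤ)

/-- The monomial quasisymmetric function `M_β = ∑_{f 1 < ⋯ < f l} x_{f 1}^{β_1} ⋯ x_{f l}^{β_l}`. -/
def monomialQSym {n : ℕ} (β : Composition n) : MvPowerSeries ℕ+ ℤ := fun m =>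
  (Nat.card {f : Fin β.length → ℕ+ //
    StrictMono f ∧ ∑ j, Finsupp.single (f j) (β.blocksFun j) = m} : ℤ)

/-- The composition `β` refines the composition `α`: every partial sum of `α` is one of `β`. -/
def Refines {n : ℕ} (β α : Composition n) : Prop :=
  α.boundaries ⊆ β.boundaries

/-- The fundamental quasisymmetric function `L_α = ∑_{β refines α} M_β`. -/
def fundamentalQSym {n : ℕ} (α : Composition n) : MvPowerSeries ℕ+ ℤ :=
  ∑ β : Composition n with Refines β α, monomialQSym β

/-- A quasisymmetric function, homogeneous of degree `n`, is `L`-positive if it is a combination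
of the fundamental quasisymmetric functions with non-negative coefficients. -/
def LPositive (n : ℕ) (F : MvPowerSeries ℕ+ ℤ) : Prop :=
  ∃ c : Composition n → ℤ, (∀ α, 0 ≤ c α) ∧ F = ∑ α, c α • fundamentalQSym α

/-! ### Decision trees and their cells -/

/-- An inequality `x i ≤ x j` (`le i j`) or `x i < x j` (`lt i j`). -/
inductive Ineq (n : ℕ) : Type
  | le (i j : Fin n) : Ineq n
  | lt (i j : Fin n) : Ineq n

/-- Truth of an inequality at a point. -/
def Ineq.Holds {n : ℕ} : Ineq n → (Fin n → ℝ) → Prop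
  | .le i j, x => x i ≤ x j
  | .lt i j, x => x i < x j

/-- The negation of an inequality, again an inequality. -/
def Ineq.neg {n : ℕ} : Ineq n → Ineq n
  | .le i j => .lt j i
  | .lt i j => .le j i

/-- A decision tree: a leaf, which is a conjunction of inequalities (given as a list), or
`if φ then t else f` with an inequality `φ` and decision trees `t`, `f`. -/
inductive DecisionTree (n : ℕ) : Type
  | leaf (ψ : List (Ineq n)) : DecisionTree n
  | ite (φ : Ineq n) (t f : DecisionTree n) : DecisionTree n

/-- Truth of a decision tree at a point. -/
def DecisionTree.Holds {n : ℕ} : DecisionTree n → (Fin n → ℝ) → Prop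
  | .leaf ψ, x => ∀ I ∈ ψ, I.Holds x
  | .ite φ t f, x => if φ.Holds x then t.Holds x else f.Holds x

/-- The cells of a decision tree, one for each leaf: the conjunction of the inequalities of the
leaf and of the conditions on the way to it, negated where the way takes the `else` branch. -/
def DecisionTree.cells {n : ℕ} : DecisionTree n → List (List (Ineq n))
  | .leaf ψ => [ψ]
  | .ite φ t f => t.cells.map (fun C => φ :: C) ++ f.cells.map (fun C => φ.neg :: C)

/-- The set of solutions of a conjunction of inequalities in the open unit cube. -/
def cellPolytope {n : ℕ} (C : List (Ineq n)) : Set (Fin n → ℝ) :=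
  {x | (∀ I ∈ C, I.Holds x) ∧ ∀ i, 0 < x i ∧ x i < 1}

/-! ### Almost open sets -/

/-- A linear inequality `∑ i, coeff i * x i ≤ bound` (if `weak`) or
`∑ i, coeff i * x i < bound` (if not `weak`) on real `n`-space. -/
structure LinIneq (n : ℕ) where
  coeff : Fin n → ℝ
  bound : ℝ
  weak : Prop

/-- Truth of a linear inequality at a point. -/
def LinIneq.Holds {n : ℕ} (I : LinIneq n) (x : Fin n → ℝ) : Prop :=
  if I.weak then ∑ i, I.coeff i * x i ≤ I.bound else ∑ i, I.coeff i * x i < I.bound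

/-- The dimension of (the affine span of) a non-empty set. -/
def dim {n : ℕ} (P : Set (Fin n → ℝ)) : ℕ :=
  Module.finrank ℝ (vectorSpan ℝ P)

/-- `I` is facet-defining for the polyhedron `P`: its weak form is valid on `P`, and the points of
the closure of `P` where it is an equality form a facet, that is, a (non-empty) face whose
dimension is one less than that of `P`. -/
def LinIneq.FacetDefining {n : ℕ} (I : LinIneq n) (P : Set (Fin n → ℝ)) : Prop :=
  (∀ x ∈ P, ∑ i, I.coeff i * x i ≤ I.bound) ∧
  (closure P ∩ {x | ∑ i, I.coeff i * x i = I.bound}).Nonempty ∧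
  dim (closure P ∩ {x | ∑ i, I.coeff i * x i = I.bound}) + 1 = dim P

/-- `P` is almost open: it is the solution set of a finite conjunction of inequalities that are
all facet-defining for `P` and of which at most one is weak. -/
def AlmostOpen {n : ℕ} (P : Set (Fin n → ℝ)) : Prop :=
  ∃ (r : ℕ) (I : Fin r → LinIneq n),
    P = {x | ∀ j, (I j).Holds x} ∧
    (∀ j, (I j).FacetDefining P) ∧
    (∀ j j', (I j).weak → (I j').weak → j = j')

end Scheduling

end

open Finset Filter Topology

/-! ### Compositions as patterns of forced strict increases -/

namespace Composition

variable {n : ℕ} (c : Composition n)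

/-! An almost open cell admits a point `q` with distinct coordinates, strictly inside the strict
inequalities and strictly outside the weak one if that is attained. Pushing any `x` slightly away
from `q` then preserves membership and non-membership (`AlmostOpen.exists_breaksTies`), and breaks
all ties of `x`. Since a cell is cut out of the cube by order inequalities, membership of `x`
depends only on the permutation that sorts `x` with ties broken by `q`
(`mem_cellPolytope_iff_of_sortedBy`).

So the solutions in a cell split by sorting permutation. Once rearranged, each class consists of the
functions compatible with one composition (`exists_compatible_iff_sortedBy`). These are enumerated
by a fundamental quasisymmetric function (`fundamentalQSym_apply`) and, in `[k]`, by a binomial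
coefficient (`card_compatible_Icc`). `Decomposable` records this with coefficients independent of
the value set, so the same coefficients, added over the disjoint cells, give both conclusions. -/

theorem lt_sizeUpTo_iff (i : Fin n) (l : ℕ) :
    (i : ℕ) < c.sizeUpTo l ↔ (c.index i : ℕ) < l := by
  constructor
  · intro h
    by_contra! hl
    exact absurd (c.monotone_sizeUpTo hl) (not_le.2 ((c.sizeUpTo_index_le i).trans_lt h))
  · intro h
    exact (c.lt_sizeUpTo_index_succ i).trans_le (c.monotone_sizeUpTo (Nat.succ_le_of_lt h))

theorem mem_boundaries_iff (k : Fin (n + 1)) :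
    k ∈ c.boundaries ↔ ∃ l, c.sizeUpTo l = k := by
  simp only [boundaries, Finset.mem_map, Finset.mem_univ, true_and]
  constructor
  · rintro ⟨l, rfl⟩
    exact ⟨l, rfl⟩
  · rintro ⟨l, hl⟩
    rcases le_total l c.length with h | h
    · exact ⟨⟨l, Nat.lt_succ_of_le h⟩, Fin.ext hl⟩
    · refine ⟨Fin.last _, Fin.ext ?_⟩
      rw [← hl, c.sizeUpTo_ofLength_le l h]
      exact c.sizeUpTo_length

theorem index_lt_index_iff (i j : Fin n) :
    c.index i < c.index j ↔ ∃ k ∈ c.boundaries, (i : ℕ) < k ∧ (k : ℕ) ≤ j := by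
  constructor
  · intro h
    refine ⟨⟨c.sizeUpTo (c.index j), Nat.lt_succ_of_le (c.sizeUpTo_le _)⟩,
      (c.mem_boundaries_iff _).2 ⟨_, rfl⟩, (c.lt_sizeUpTo_iff i _).2 h, c.sizeUpTo_index_le j⟩
  · rintro ⟨k, hk, hik, hkj⟩
    obtain ⟨l, hl⟩ := (c.mem_boundaries_iff k).1 hk
    have h1 := (c.lt_sizeUpTo_iff i l).1 (by omega)
    have h2 := mt (c.lt_sizeUpTo_iff j l).2 (by omega)
    exact Fin.lt_def.2 (by omega)

theorem index_monotone : Monotone c.index := by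
  intro i j hij
  by_contra! h
  obtain ⟨k, -, h1, h2⟩ := (c.index_lt_index_iff j i).1 h
  have : (i : ℕ) ≤ j := hij
  omega

theorem boundaries_subset_iff (d : Composition n) :
    c.boundaries ⊆ d.boundaries ↔ ∀ i j, c.index i < c.index j → d.index i < d.index j := by
  constructor
  · intro h i j hij
    obtain ⟨k, hk, h'⟩ := (c.index_lt_index_iff i j).1 hij
    exact (d.index_lt_index_iff i j).2 ⟨k, h hk, h'⟩
  · intro h k hk
    rcases Nat.eq_zero_or_pos (k : ℕ) with h0 | h0
    · exact (d.mem_boundaries_iff k).2 ⟨0, by simp [h0]⟩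
    rcases (Nat.lt_succ_iff.1 k.2).eq_or_lt with hn | hn
    · exact (d.mem_boundaries_iff k).2 ⟨d.length, by simp [hn]⟩
    obtain ⟨k', hk', h1, h2⟩ := (d.index_lt_index_iff _ _).1
      (h ⟨k - 1, by omega⟩ ⟨k, hn⟩ ((c.index_lt_index_iff _ _).2 ⟨k, hk, by change (k : ℕ) - 1 < k; omega, le_rfl⟩))
    have : k = k' := Fin.ext (by simp at h1 h2; omega)
    exact this ▸ hk'

theorem boundaries_injective :
    Function.Injective (boundaries : Composition n → Finset (Fin (n + 1))) := fun _ _ h =>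
  (compositionEquiv n).injective (CompositionAsSet.ext h)

/-- Cut at every `k` with `D k`. The compulsory boundaries `0` and `n` do no harm, as `i < k ≤ j`
excludes both. -/
theorem exists_index_lt_iff (D : ℕ → Prop) :
    ∃ c : Composition n, ∀ i j : Fin n,
      c.index i < c.index j ↔ ∃ k, (i : ℕ) < k ∧ k ≤ j ∧ D k := by
  classical
  let s : CompositionAsSet n :=
    { boundaries := {k | (k : ℕ) = 0 ∨ (k : ℕ) = n ∨ D k}
      zero_mem := by simp
      getLast_mem := by simp }
  refine ⟨s.toComposition, fun i j => ?_⟩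
  rw [index_lt_index_iff, CompositionAsSet.toComposition_boundaries]
  constructor
  · rintro ⟨k, hk, h1, h2⟩
    have := j.2
    refine ⟨k, h1, h2, ?_⟩
    rcases (Finset.mem_filter.1 hk).2 with h | h | h
    · omega
    · omega
    · exact h
  · rintro ⟨k, h1, h2, h3⟩
    have := j.2
    exact ⟨⟨k, by omega⟩, Finset.mem_filter.2 ⟨Finset.mem_univ _, .inr (.inr h3)⟩, h1, h2⟩

/-- `b` is weakly increasing, and strictly increasing from each block of `c` to the next one. -/
def Compatible {ω : Type*} [Preorder ω] (b : Fin n → ω) : Prop :=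
  Monotone b ∧ ∀ i j, c.index i < c.index j → b i < b j

theorem index_embedding_zero (l : Fin c.length) :
    c.index (c.embedding l ⟨0, c.one_le_blocksFun l⟩) = l :=
  c.index_embedding _ _

theorem exists_strictMono_comp_index {ω : Type*} [LinearOrder ω] {b : Fin n → ω}
    (hb : Monotone b) :
    ∃ (c : Composition n) (f : Fin c.length → ω), StrictMono f ∧ f ∘ c.index = b := by
  obtain ⟨c, hc⟩ := exists_index_lt_iff (n := n)
    (fun k => ∃ i j : Fin n, (i : ℕ) + 1 = k ∧ (j : ℕ) = k ∧ b i < b j)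
  have key : ∀ i j, c.index i < c.index j ↔ b i < b j := by
    intro i j
    rw [hc]
    constructor
    · rintro ⟨k, h1, h2, i', j', h3, h4, h5⟩
      exact (hb (Fin.le_def.2 (by omega))).trans_lt
        (h5.trans_le (hb (Fin.le_def.2 (by omega))))
    · intro h
      by_contra! hk
      -- Without an ascent between neighbours, `b` cannot rise anywhere from `i` to `j`.
      have : ∀ (l : ℕ) (hl : l < n), (i : ℕ) ≤ l → l ≤ j → b ⟨l, hl⟩ ≤ b i := by
        intro l
        induction l with
        | zero =>
          intro hl h1 _
          exact hb (Fin.le_def.2 (by simp))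
        | succ l ih =>
          intro hl h1 h2
          rcases h1.eq_or_lt with h1 | h1
          · exact hb (Fin.le_def.2 h1.ge)
          · refine le_trans ?_ (ih (by omega) (by omega) (by omega))
            by_contra! hlt
            exact absurd (hk (l + 1) h1 h2 ⟨l, by omega⟩ ⟨l + 1, hl⟩ rfl rfl) (not_le.2 hlt)
      have hij : (i : ℕ) ≤ j := by
        by_contra! hji
        exact absurd (hb (Fin.le_def.2 hji.le)) (not_le.2 h)
      exact absurd (this j j.2 hij le_rfl) (not_le.2 h)
  refine ⟨c, fun l => b (c.embedding l ⟨0, c.one_le_blocksFun l⟩), fun l l' h => ?_, ?_⟩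
  · rw [← key, c.index_embedding_zero, c.index_embedding_zero]
    exact h
  · funext i
    refine le_antisymm (not_lt.1 fun h => ?_) (not_lt.1 fun h => ?_) <;>
    · rw [Function.comp_apply, ← key, c.index_embedding_zero] at h
      exact lt_irrefl _ h

theorem index_surjective : Function.Surjective c.index := fun l =>
  ⟨_, c.index_embedding_zero l⟩

theorem index_lt_index_iff_of_comp {ω : Type*} [LinearOrder ω] {f : Fin c.length → ω}
    (hf : StrictMono f) (i j : Fin n) :
    c.index i < c.index j ↔ (f ∘ c.index) i < (f ∘ c.index) j :=
  (hf.lt_iff_lt).symm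

theorem compatible_comp_index_iff {ω : Type*} [LinearOrder ω] (d : Composition n)
    {f : Fin d.length → ω} (hf : StrictMono f) :
    c.Compatible (f ∘ d.index) ↔ c.boundaries ⊆ d.boundaries := by
  rw [boundaries_subset_iff, Compatible,
    and_iff_right (hf.monotone.comp d.index_monotone)]
  simp only [Function.comp_apply, hf.lt_iff_lt]

theorem eq_of_comp_index_eq {ω : Type*} [LinearOrder ω] {d : Composition n}
    {f : Fin c.length → ω} {g : Fin d.length → ω} (hf : StrictMono f) (hg : StrictMono g)
    (h : f ∘ c.index = g ∘ d.index) : c = d := by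
  refine boundaries_injective (Finset.Subset.antisymm ?_ ?_)
  · rw [boundaries_subset_iff]
    intro i j
    rw [c.index_lt_index_iff_of_comp hf, h, d.index_lt_index_iff_of_comp hg]
    exact id
  · rw [boundaries_subset_iff]
    intro i j
    rw [c.index_lt_index_iff_of_comp hf, h, d.index_lt_index_iff_of_comp hg]
    exact id

theorem sum_comp_index {M : Type*} [AddCommMonoid M] (f : Fin c.length → M) :
    ∑ i, f (c.index i) = ∑ l, c.blocksFun l • f l := by
  rw [← c.sum_sum_apply_embedding]
  simp

theorem index_last_add_one (i : Fin n) (h : (i : ℕ) + 1 = n) :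
    (c.index i : ℕ) + 1 = c.length := by
  have h2 := (c.index i).2
  by_contra hne
  obtain ⟨j, hj⟩ := c.index_surjective ⟨c.length - 1, by omega⟩
  have : c.index j ≤ c.index i := c.index_monotone (Fin.le_def.2 (by omega))
  rw [hj, Fin.le_def] at this
  simp at this
  omega

/-- The index grows by at most one per item: a larger jump would skip a block, but no block is
empty. -/
theorem index_add_le (i j : Fin n) (h : i ≤ j) :
    (c.index j : ℕ) + i ≤ c.index i + j := by
  have key : ∀ (d : ℕ) (hd : (i : ℕ) + d < n), (c.index ⟨i + d, hd⟩ : ℕ) ≤ c.index i + d := by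
    intro d
    induction d with
    | zero => intro _; simp
    | succ d ih =>
      intro hd
      have h1 := ih (by omega)
      by_contra! h2
      have hlt : (c.index ⟨i + d, by omega⟩ : ℕ) + 1 < c.index ⟨i + (d + 1), hd⟩ := by omega
      obtain ⟨m, hm⟩ := c.index_surjective
        ⟨(c.index ⟨i + d, by omega⟩ : ℕ) + 1, hlt.trans (Fin.is_lt _)⟩
      have hm' := congrArg Fin.val hm
      simp only at hm'
      rcases le_or_gt (m : ℕ) (i + d) with h3 | h3
      · have : c.index m ≤ c.index ⟨i + d, by omega⟩ := c.index_monotone (Fin.le_def.2 h3)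
        rw [Fin.le_def] at this
        omega
      · have : c.index ⟨i + (d + 1), hd⟩ ≤ c.index m := c.index_monotone (Fin.le_def.2 h3)
        rw [Fin.le_def] at this
        omega
  have h' : (i : ℕ) ≤ j := h
  have := key (j - i) (by omega)
  have e : (⟨(i : ℕ) + (j - i), by omega⟩ : Fin n) = j := Fin.ext (by simp; omega)
  rw [e] at this
  omega

theorem index_le_self (i : Fin n) : (c.index i : ℕ) ≤ i := by
  have hn : 0 < n := i.pos
  have h1 := c.index_add_le ⟨0, hn⟩ i (Fin.le_def.2 (Nat.zero_le _))
  have h2 := c.lt_sizeUpTo_iff ⟨0, hn⟩ (c.index ⟨0, hn⟩)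
  have h3 := c.sizeUpTo_index_le ⟨0, hn⟩
  simp only at h1 h2 h3
  have h4 : c.sizeUpTo (c.index ⟨0, hn⟩) = 0 := by omega
  have h5 : (c.index ⟨0, hn⟩ : ℕ) = 0 := by
    by_contra h5
    have := (c.lt_sizeUpTo_iff ⟨0, hn⟩ 1).1 (by
      have := c.sizeUpTo_strict_mono (c.length_pos_iff.2 hn)
      rw [c.sizeUpTo_zero] at this
      exact this)
    omega
  omega

theorem add_length_le (i : Fin n) : (i : ℕ) + c.length ≤ c.index i + n := by
  have hn : 0 < n := i.pos
  have h1 := c.index_last_add_one ⟨n - 1, by omega⟩ (Nat.sub_add_cancel hn)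
  have h2 := c.index_add_le i ⟨n - 1, by omega⟩ (Fin.le_def.2 (Nat.le_sub_one_of_lt i.2))
  simp only at h2
  omega

end Composition

/-! ### Counting compatible functions with values in `[k]` -/

theorem StrictMono.add_sub_le_apply {n : ℕ} {f : Fin n → ℕ} (hf : StrictMono f) {i j : Fin n}
    (h : i ≤ j) : f i + (j - i : ℕ) ≤ f j := by
  have key : ∀ (d : ℕ) (hd : (i : ℕ) + d < n), f i + d ≤ f ⟨i + d, hd⟩ := by
    intro d
    induction d with
    | zero => intro _; simp
    | succ d ih =>
      intro hd
      have h1 := ih (by omega)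
      have h2 : f ⟨i + d, by omega⟩ < f ⟨i + (d + 1), hd⟩ :=
        hf (Fin.lt_def.2 (by simp))
      omega
  have h' : (i : ℕ) ≤ j := h
  have := key (j - i) (by omega)
  have e : (⟨(i : ℕ) + (j - i), by omega⟩ : Fin n) = j := Fin.ext (by simp; omega)
  rwa [e] at this

theorem StrictMono.self_le_apply_fin {n : ℕ} {f : Fin n → ℕ} (hf : StrictMono f) (i : Fin n) :
    (i : ℕ) ≤ f i := by
  have h := hf.add_sub_le_apply (i := ⟨0, i.pos⟩) (j := i) (Fin.le_def.2 (Nat.zero_le _))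
  simp only at h
  omega

theorem StrictMono.apply_add_lt_of_fin {n N : ℕ} {f : Fin n → ℕ} (hf : StrictMono f)
    (hN : ∀ i, f i < N) (i : Fin n) : f i + n ≤ N + i := by
  have hn := i.pos
  have h := hf.add_sub_le_apply (i := i) (j := ⟨n - 1, by omega⟩)
    (Fin.le_def.2 (Nat.le_sub_one_of_lt i.2))
  have := hN ⟨n - 1, by omega⟩
  simp only at h
  omega

namespace Composition

variable {n : ℕ} (c : Composition n)

/-- Adding to a compatible function the number of steps inside the blocks makes it strictly
increasing. -/
def compatibleEquiv (k : ℕ) :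
    {b : Fin n → Set.Icc 1 k // c.Compatible b} ≃ (Fin n ↪o Fin (k + n - c.length)) where
  toFun b := OrderEmbedding.ofStrictMono
    -- Up to item `i` there are `i - c.index i` steps inside blocks; the `- 1` makes values start at
    -- `0`. The maximum is `(k - 1) + (n - 1) - (c.length - 1)`.
    (fun i => ⟨(b.1 i : ℕ) - 1 + i - c.index i, by
      have h1 : (b.1 i : ℕ) ≤ k := (b.1 i).2.2
      have h2 : 1 ≤ (b.1 i : ℕ) := (b.1 i).2.1
      have h3 := c.add_length_le i
      have h4 := c.length_le
      omega⟩)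
    (fun i j hij => by
      have h1 : 1 ≤ (b.1 i : ℕ) := (b.1 i).2.1
      have h2 : (b.1 i : ℕ) ≤ b.1 j := b.2.1 hij.le
      have h3 := c.index_le_self i
      have h4 := c.index_add_le i j hij.le
      have h5 : (c.index i : ℕ) < c.index j → (b.1 i : ℕ) < b.1 j := b.2.2 i j
      have h6 : (c.index i : ℕ) ≤ c.index j := c.index_monotone hij.le
      have h7 : (i : ℕ) < j := hij
      rw [Fin.lt_def]
      simp only
      omega)
  invFun f := ⟨fun i => ⟨(f i : ℕ) + 1 + c.index i - i, by
      have hf : StrictMono fun i => (f i : ℕ) := f.strictMono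
      have h1 := hf.self_le_apply_fin i
      have h2 := hf.apply_add_lt_of_fin (fun i => (f i).2) i
      have h3 := (c.index i).2
      have h4 := c.length_le
      constructor <;> omega⟩, by
      have hf : StrictMono fun i => (f i : ℕ) := f.strictMono
      constructor
      · intro i j hij
        have h1 := hf.add_sub_le_apply hij
        have h2 := hf.self_le_apply_fin i
        have h3 := hf.self_le_apply_fin j
        have h4 : (c.index i : ℕ) ≤ c.index j := c.index_monotone hij
        have h5 : (i : ℕ) ≤ j := hij
        change (f i : ℕ) + 1 + c.index i - i ≤ (f j : ℕ) + 1 + c.index j - j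
        omega
      · intro i j hij
        have hle : i ≤ j := not_lt.1 fun h => not_lt.2 (c.index_monotone h.le) hij
        have h1 := hf.add_sub_le_apply hle
        have h2 := hf.self_le_apply_fin i
        have h3 := hf.self_le_apply_fin j
        have h4 : (c.index i : ℕ) < c.index j := hij
        have h5 : (i : ℕ) ≤ j := hle
        change (f i : ℕ) + 1 + c.index i - i < (f j : ℕ) + 1 + c.index j - j
        omega⟩
  left_inv b := by
    ext i
    have h1 : 1 ≤ (b.1 i : ℕ) := (b.1 i).2.1
    have h2 := c.index_le_self i
    change (b.1 i : ℕ) - 1 + i - c.index i + 1 + c.index i - i = b.1 i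
    omega
  right_inv f := by
    ext i
    have hf : StrictMono fun i => (f i : ℕ) := f.strictMono
    have h1 := hf.self_le_apply_fin i
    change (f i : ℕ) + 1 + c.index i - i - 1 + i - c.index i = f i
    omega

theorem card_compatible_Icc (k : ℕ) :
    Nat.card {b : Fin n → Set.Icc 1 k // c.Compatible b} = (k + n - c.length).choose n := by
  rw [Nat.card_congr (c.compatibleEquiv k),
    Nat.card_congr (Set.powersetCard.ofFinEmbEquiv (n := n) (I := Fin (k + n - c.length))),
    Set.powersetCard.card, Nat.card_fin]

end Composition

/-! ### Coefficients of fundamental quasisymmetric functions -/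

namespace Scheduling

theorem finite_sum_single_eq {ι ω : Type*} [Fintype ι] (e : ι → ℕ) (he : ∀ i, e i ≠ 0)
    (m : ω →₀ ℕ) :
    {b : ι → ω | ∑ i, Finsupp.single (b i) (e i) = m}.Finite := by
  classical
  refine (Set.Finite.pi' fun _ : ι => m.support.finite_toSet).subset ?_
  rintro b rfl i
  rw [Finset.mem_coe, Finsupp.mem_support_iff, Finsupp.finsetSum_apply]
  exact fun h => he i (by simpa using (Finset.sum_eq_zero_iff.1 h) i (Finset.mem_univ i))

theorem sum_single_comp_index {n : ℕ} {ω : Type*} (β : Composition n) (f : Fin β.length → ω) :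
    ∑ i, Finsupp.single ((f ∘ β.index) i) 1 =
      ∑ j, Finsupp.single (f j) (β.blocksFun j) := by
  simp only [Function.comp_apply]
  rw [β.sum_comp_index (fun l => Finsupp.single (f l) 1)]
  simp

/-- A monotone `b` is uniquely a strictly increasing function on the blocks of its level composition
`β`, and it is compatible with `α` exactly when `β` refines `α`. -/
theorem fundamentalQSym_apply {n : ℕ} (α : Composition n) (m : ℕ+ →₀ ℕ) :
    fundamentalQSym α m =
      (Nat.card {b : Fin n → ℕ+ // α.Compatible b ∧ ∑ i, Finsupp.single (b i) 1 = m} : ℤ) := by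
  classical
  have h1 : fundamentalQSym α m =
      ∑ β : {β : Composition n // Refines β α}, (Nat.card {f : Fin β.1.length → ℕ+ //
        StrictMono f ∧ ∑ j, Finsupp.single (f j) (β.1.blocksFun j) = m} : ℤ) := by
    change MvPowerSeries.coeff m (fundamentalQSym α) = _
    rw [fundamentalQSym, map_sum, ← Finset.sum_subtype_eq_sum_filter]
    refine Finset.sum_congr (by ext; simp) fun _ _ => rfl
  have hfin (β : Composition n) : Finite {f : Fin β.length → ℕ+ //
        StrictMono f ∧ ∑ j, Finsupp.single (f j) (β.blocksFun j) = m} :=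
    ((finite_sum_single_eq β.blocksFun
      (fun i => Nat.one_le_iff_ne_zero.1 (β.one_le_blocksFun i)) m).subset fun _ h => h.2)
  rw [h1, ← Nat.cast_sum, ← Nat.card_sigma]
  congr 1
  refine Nat.card_eq_of_bijective (fun x => ⟨x.2.1 ∘ x.1.1.index,
    (α.compatible_comp_index_iff _ x.2.2.1).2 x.1.2, ?_⟩) ⟨?_, ?_⟩
  · exact (sum_single_comp_index _ _).trans x.2.2.2
  · rintro ⟨⟨β, hβ⟩, f, hf, hfm⟩ ⟨⟨γ, hγ⟩, g, hg, hgm⟩ h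
    have h := congrArg Subtype.val h
    simp only at h
    obtain rfl := β.eq_of_comp_index_eq hf hg h
    obtain rfl := β.index_surjective.injective_comp_right h
    rfl
  · rintro ⟨b, hb, hm⟩
    obtain ⟨β, f, hf, rfl⟩ := Composition.exists_strictMono_comp_index hb.1
    refine ⟨⟨⟨β, (α.compatible_comp_index_iff _ hf).1 hb⟩, f, hf, ?_⟩, rfl⟩
    exact (sum_single_comp_index _ _).symm.trans hm

theorem exists_polynomial_eval_eq_choose (n r : ℕ) :
    ∃ p : Polynomial ℚ, ∀ k : ℕ, p.eval (k : ℚ) = ((k + r).choose n : ℚ) := by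
  refine ⟨Polynomial.C ((n.factorial : ℚ)⁻¹) *
    (descPochhammer ℚ n).comp (Polynomial.X + Polynomial.C (r : ℚ)), fun k => ?_⟩
  rw [Nat.cast_choose_eq_descPochhammer_div]
  simp [div_eq_inv_mul]

/-! ### Tie-breaking points for almost open sets -/

variable {n : ℕ}

/-- A tie-breaking direction for `P`: membership in `P` does not change when a point is pushed
slightly away from `q`. -/
def BreaksTies (q : Fin n → ℝ) (P : Set (Fin n → ℝ)) : Prop :=
  ∀ x, ∀ᶠ ε : ℝ in 𝓝[>] 0, x ∈ P ↔ x + ε • (x - q) ∈ P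

/-- Finitely many hyperplanes `q i = q j` have dense open complements, hence so does their union. -/
theorem exists_injective_mem {U : Set (Fin n → ℝ)} (hU : IsOpen U) (hne : U.Nonempty) :
    ∃ q ∈ U, Function.Injective q := by
  have hd (p : {p : Fin n × Fin n // p.1 ≠ p.2}) :
      IsOpen {q : Fin n → ℝ | q p.1.1 ≠ q p.1.2} ∧
        Dense {q : Fin n → ℝ | q p.1.1 ≠ q p.1.2} := by
    obtain ⟨⟨i, j⟩, hij⟩ := p
    refine ⟨isOpen_ne_fun (continuous_apply i) (continuous_apply j), fun x => ?_⟩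
    by_cases hx : x i = x j
    · have hc : Tendsto (fun ε : ℝ => x + ε • Pi.single i (1 : ℝ)) (𝓝[>] 0) (𝓝 x) := by
        have : Continuous fun ε : ℝ => x + ε • Pi.single i (1 : ℝ) := by fun_prop
        simpa using (this.tendsto 0).mono_left nhdsWithin_le_nhds
      refine mem_closure_of_tendsto hc ?_
      filter_upwards [self_mem_nhdsWithin] with ε hε
      have hji : j ≠ i := fun h => hij h.symm
      simp only [Pi.add_apply, Pi.smul_apply, Pi.single_eq_same,
        Pi.single_eq_of_ne hji, hx, smul_eq_mul, mul_one, mul_zero, add_zero, ne_eq]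
      have : (0 : ℝ) < ε := hε
      linarith
    · exact subset_closure hx
  have hD : Dense (⋂ p : {p : Fin n × Fin n // p.1 ≠ p.2},
      {q : Fin n → ℝ | q p.1.1 ≠ q p.1.2}) :=
    dense_iInter_of_isOpen (fun p => (hd p).1) (fun p => (hd p).2)
  obtain ⟨q, hqU, hq⟩ := hD.inter_open_nonempty U hU hne
  refine ⟨q, hqU, fun i j h => ?_⟩
  by_contra hij
  exact Set.mem_iInter.1 hq ⟨(i, j), hij⟩ h

/-- Only `x` on the bounding hyperplane is delicate: moving away from `q` enters the half-space if
`q` is outside it and leaves it if `q` is inside. -/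
theorem LinIneq.eventually_holds (I : LinIneq n) {q x : Fin n → ℝ}
    (hs : ¬ I.weak → ∑ i, I.coeff i * q i < I.bound)
    (hw : I.weak → I.bound < ∑ i, I.coeff i * q i) :
    ∀ᶠ ε : ℝ in 𝓝[>] 0, I.Holds x ↔ I.Holds (x + ε • (x - q)) := by
  set s := ∑ i, I.coeff i * x i with hs'
  set t := ∑ i, I.coeff i * q i with ht'
  have hsum (ε : ℝ) : ∑ i, I.coeff i * (x + ε • (x - q)) i = s + ε * (s - t) := by
    rw [hs', ht', ← Finset.sum_sub_distrib, Finset.mul_sum, ← Finset.sum_add_distrib]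
    refine Finset.sum_congr rfl fun i _ => ?_
    simp only [Pi.add_apply, Pi.smul_apply, Pi.sub_apply, smul_eq_mul]
    ring
  have hc : Tendsto (fun ε : ℝ => s + ε * (s - t)) (𝓝[>] 0) (𝓝 s) := by
    have : Continuous fun ε : ℝ => s + ε * (s - t) := by fun_prop
    simpa using (this.tendsto 0).mono_left nhdsWithin_le_nhds
  have hpos : ∀ᶠ ε : ℝ in 𝓝[>] 0, 0 < ε := self_mem_nhdsWithin
  simp only [LinIneq.Holds, hsum, ← hs']
  by_cases h : I.weak
  · simp only [h, if_true]
    have hw := hw h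
    rcases lt_or_ge I.bound s with h1 | h1
    · filter_upwards [hc.eventually_const_lt h1] with ε hε
      exact iff_of_false (not_le.2 h1) (not_le.2 hε)
    · filter_upwards [hpos] with ε hε
      exact iff_of_true h1 (by nlinarith)
  · simp only [h, if_false]
    have hs := hs h
    rcases lt_or_ge s I.bound with h1 | h1
    · filter_upwards [hc.eventually_lt_const h1] with ε hε
      exact iff_of_true h1 hε
    · filter_upwards [hpos] with ε hε
      exact iff_of_false (not_lt.2 h1) (not_lt.2 (by nlinarith))

theorem breaksTies_of_forall {r : ℕ} {I : Fin r → LinIneq n} {q : Fin n → ℝ}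
    (hs : ∀ j, ¬ (I j).weak → ∑ i, (I j).coeff i * q i < (I j).bound)
    (hw : ∀ j, (I j).weak → (I j).bound < ∑ i, (I j).coeff i * q i) :
    BreaksTies q {x | ∀ j, (I j).Holds x} := by
  intro x
  filter_upwards [eventually_all.2 fun j => (I j).eventually_holds (x := x) (hs j) (hw j)]
    with ε hε
  exact forall_congr' hε

/-- With zero normal the non-empty face would be all of `closure P`, too large to be a facet. -/
theorem LinIneq.FacetDefining.coeff_ne_zero {I : LinIneq n} {P : Set (Fin n → ℝ)}
    (h : I.FacetDefining P) : I.coeff ≠ 0 := by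
  intro h0
  obtain ⟨-, ⟨y, -, hy⟩, hd⟩ := h
  have hb : I.bound = 0 := by simpa [h0] using hy.symm
  have hset : closure P ∩ {x | ∑ i, I.coeff i * x i = I.bound} = closure P := by
    simp [h0, hb]
  rw [hset] at hd
  have hle : vectorSpan ℝ P ≤ vectorSpan ℝ (closure P) := vectorSpan_mono ℝ subset_closure
  have := Submodule.finrank_mono hle
  unfold dim at hd
  omega

theorem AlmostOpen.exists_breaksTies {P : Set (Fin n → ℝ)} (h : AlmostOpen P)
    (hne : P.Nonempty) : ∃ q, Function.Injective q ∧ BreaksTies q P := by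
  classical
  obtain ⟨r, I, hP, hf, hw⟩ := h
  have hopen (j : Fin r) (b : ℝ) : IsOpen {q : Fin n → ℝ | ∑ i, (I j).coeff i * q i < b} :=
    isOpen_lt (by fun_prop) continuous_const
  have hopen' (j : Fin r) (b : ℝ) : IsOpen {q : Fin n → ℝ | b < ∑ i, (I j).coeff i * q i} :=
    isOpen_lt continuous_const (by fun_prop)
  have hlt {x} (hx : x ∈ P) {j} (hj : ¬ (I j).weak) :
      ∑ i, (I j).coeff i * x i < (I j).bound := by
    rw [hP] at hx
    simpa [LinIneq.Holds, hj] using hx j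
  by_cases hB : ∃ w x, (I w).weak ∧ x ∈ P ∧ ∑ i, (I w).coeff i * x i = (I w).bound
  · obtain ⟨w, y, hww, hy, hyw⟩ := hB
    set U : Set (Fin n → ℝ) := ⋂ j, {q | (¬ (I j).weak → ∑ i, (I j).coeff i * q i < (I j).bound)}
    set V : Set (Fin n → ℝ) := {q | (I w).bound < ∑ i, (I w).coeff i * q i}
    have hU : IsOpen U := by
      refine isOpen_iInter_of_finite fun j => ?_
      by_cases hj : (I j).weak
      · simp [hj]
      · simpa [hj] using hopen j _
    have hpos : 0 < ∑ i, (I w).coeff i * (I w).coeff i := by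
      obtain ⟨i, hi⟩ := Function.ne_iff.1 (hf w).coeff_ne_zero
      exact Finset.sum_pos' (fun i _ => mul_self_nonneg _)
        ⟨i, Finset.mem_univ i, mul_self_pos.2 hi⟩
    -- From a point `y` of `P` on the weak facet, a short step along the outward normal violates the
    -- weak inequality and keeps the strict ones.
    have hc : Tendsto (fun ε : ℝ => y + ε • (I w).coeff) (𝓝[>] 0) (𝓝 y) := by
      have : Continuous fun ε : ℝ => y + ε • (I w).coeff := by fun_prop
      simpa using (this.tendsto 0).mono_left nhdsWithin_le_nhds
    have hyU : y ∈ U := Set.mem_iInter.2 fun j hj => hlt hy hj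
    have hev : ∀ᶠ ε : ℝ in 𝓝[>] 0, y + ε • (I w).coeff ∈ U ∩ V := by
      filter_upwards [hc.eventually_mem (hU.mem_nhds hyU), self_mem_nhdsWithin] with ε h1 h2
      refine ⟨h1, ?_⟩
      have h2 : (0 : ℝ) < ε := h2
      have : ∑ i, (I w).coeff i * (y + ε • (I w).coeff) i =
          (I w).bound + ε * ∑ i, (I w).coeff i * (I w).coeff i := by
        rw [← hyw, Finset.mul_sum, ← Finset.sum_add_distrib]
        refine Finset.sum_congr rfl fun i _ => ?_
        simp only [Pi.add_apply, Pi.smul_apply, smul_eq_mul]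
        ring
      change (I w).bound < ∑ i, (I w).coeff i * (y + ε • (I w).coeff) i
      rw [this]
      nlinarith [mul_pos h2 hpos]
    obtain ⟨ε, hε⟩ := hev.exists
    obtain ⟨q, ⟨hqU, hqV⟩, hq⟩ := exists_injective_mem (hU.inter (hopen' w _)) ⟨_, hε⟩
    refine ⟨q, hq, hP ▸ breaksTies_of_forall (fun j => Set.mem_iInter.1 hqU j) fun j hj => ?_⟩
    rw [hw j w hj hww]
    exact hqV
  -- If no weak inequality is ever tight on `P`, all may be read as strict; `P` is open and `q` can
  -- be taken in `P`.
  · push Not at hB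
    have hPlt {x} (hx : x ∈ P) (j) : ∑ i, (I j).coeff i * x i < (I j).bound := by
      by_cases hj : (I j).weak
      · exact lt_of_le_of_ne ((hf j).1 x hx) (hB j x hj hx)
      · exact hlt hx hj
    have hP' : P = ⋂ j, {x | ∑ i, (I j).coeff i * x i < (I j).bound} := by
      ext x
      refine ⟨fun hx => Set.mem_iInter.2 (hPlt hx), fun hx => ?_⟩
      rw [hP]
      intro j
      have := Set.mem_iInter.1 hx j
      unfold LinIneq.Holds
      split_ifs
      · exact le_of_lt this
      · exact this
    have hPo : IsOpen P := hP' ▸ isOpen_iInter_of_finite fun j => hopen j _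
    obtain ⟨q, hqP, hq⟩ := exists_injective_mem hPo hne
    refine ⟨q, hq, ?_⟩
    have hP'' : P = {x | ∀ j, (LinIneq.mk (I j).coeff (I j).bound False).Holds x} := by
      rw [hP']
      ext x
      simp [LinIneq.Holds]
    rw [hP'']
    exact breaksTies_of_forall (fun j _ => hPlt hqP j) fun j hj => hj.elim

/-! ### Sorting permutations and membership in cells -/

/-- `σ` sorts `a` increasingly, with ties broken by decreasing values of `q`. -/
def SortedBy {ω : Type*} [LinearOrder ω] (q : Fin n → ℝ) (σ : Equiv.Perm (Fin n))
    (a : Fin n → ω) : Prop :=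
  ∀ i j, i < j → a (σ i) < a (σ j) ∨ a (σ i) = a (σ j) ∧ q (σ j) < q (σ i)

theorem sortedBy_comp_iff {ω ω' : Type*} [LinearOrder ω] [LinearOrder ω'] {e : ω → ω'}
    (he : StrictMono e) (q : Fin n → ℝ) (σ : Equiv.Perm (Fin n)) (a : Fin n → ω) :
    SortedBy q σ (e ∘ a) ↔ SortedBy q σ a := by
  simp only [SortedBy, Function.comp_apply, he.lt_iff_lt, he.injective.eq_iff]

theorem existsUnique_sortedBy {ω : Type*} [LinearOrder ω] {q : Fin n → ℝ}
    (hq : Function.Injective q) (a : Fin n → ω) : ∃! σ, SortedBy q σ a := by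
  let key : Fin n → ω ×ₗ ℝ := fun i => toLex (a i, -q i)
  have hkey : Function.Injective key := fun i j h =>
    hq (neg_injective (congrArg (fun p => (ofLex p).2) h))
  have hiff (σ : Equiv.Perm (Fin n)) : SortedBy q σ a ↔ StrictMono (key ∘ σ) := by
    refine forall_congr' fun i => forall_congr' fun j => imp_congr_right fun _ => ?_
    simp [key, Prod.Lex.toLex_lt_toLex]
  refine ⟨Tuple.sort key, (hiff _).2 ?_, fun σ hσ => ?_⟩
  · exact (Tuple.monotone_sort key).strictMono_of_injective
      (hkey.comp (Tuple.sort key).injective)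
  · have h := Tuple.unique_monotone ((hiff σ).1 hσ).monotone (Tuple.monotone_sort key)
    exact Equiv.ext fun i => hkey (congrFun h i)

/-- Neighbours in the order `σ` may tie only where `q` decreases, so the composition is cut wherever
`q ∘ σ` does not decrease. -/
theorem exists_compatible_iff_sortedBy (q : Fin n → ℝ) (σ : Equiv.Perm (Fin n)) :
    ∃ c : Composition n, ∀ (ω : Type) [LinearOrder ω] (a : Fin n → ω),
      SortedBy q σ a ↔ c.Compatible (a ∘ σ) := by
  obtain ⟨c, hc⟩ := Composition.exists_index_lt_iff (n := n)
    (fun k => ∃ i j : Fin n, (i : ℕ) + 1 = k ∧ (j : ℕ) = k ∧ q (σ i) ≤ q (σ j))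
  refine ⟨c, fun ω _ a => ⟨fun h => ?_, fun h i j hij => ?_⟩⟩
  · have hm : Monotone (a ∘ σ) := monotone_iff_forall_lt.2 fun i j hij =>
      (h i j hij).elim le_of_lt fun h => h.1.le
    refine ⟨hm, fun i j hij => ?_⟩
    obtain ⟨k, h1, h2, i', j', h3, h4, h5⟩ := (hc i j).1 hij
    refine (hm (Fin.le_def.2 (by omega : (i : ℕ) ≤ i'))).trans_lt
      (lt_of_lt_of_le ?_ (hm (Fin.le_def.2 (by omega : (j' : ℕ) ≤ j))))
    exact (h i' j' (Fin.lt_def.2 (by omega))).resolve_right fun h => not_lt.2 h5 h.2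
  · rcases (h.1 hij.le).lt_or_eq with hlt | heq
    · exact .inl hlt
    · refine .inr ⟨heq, ?_⟩
      have hno : ¬ c.index i < c.index j := fun h' => (h.2 i j h').ne heq
      rw [hc] at hno
      have : ∀ (l : ℕ) (hl : l < n), (i : ℕ) < l → l ≤ j → q (σ ⟨l, hl⟩) < q (σ i) := by
        intro l
        induction l with
        | zero => intro _ h1; exact absurd h1 (Nat.not_lt_zero _)
        | succ l ih =>
          intro hl h1 h2
          have hstep : q (σ ⟨l + 1, hl⟩) < q (σ ⟨l, by omega⟩) := by
            by_contra! hle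
            exact hno ⟨l + 1, h1, h2, ⟨l, by omega⟩, ⟨l + 1, hl⟩, rfl, rfl, hle⟩
          rcases (Nat.lt_succ_iff.1 h1).eq_or_lt with h1 | h1
          · have e : (⟨l, by omega⟩ : Fin n) = i := Fin.ext h1.symm
            rwa [e] at hstep
          · exact hstep.trans (ih (by omega) h1 (by omega))
      exact this j j.2 hij le_rfl

theorem Ineq.holds_iff_of_strictMono (I : Ineq n) {σ : Equiv.Perm (Fin n)} {x y : Fin n → ℝ}
    (hx : StrictMono (x ∘ σ)) (hy : StrictMono (y ∘ σ)) : I.Holds x ↔ I.Holds y := by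
  have hlt (i j) : x i < x j ↔ y i < y j := by
    have h1 := hx.lt_iff_lt (a := σ.symm i) (b := σ.symm j)
    have h2 := hy.lt_iff_lt (a := σ.symm i) (b := σ.symm j)
    simp only [Function.comp_apply, Equiv.apply_symm_apply] at h1 h2
    exact h1.trans h2.symm
  cases I with
  | le i j => simp only [Ineq.Holds, ← not_lt, hlt]
  | lt i j => exact hlt i j

/-- Strict inequalities survive small pushes; a tie opens up by `ε * (q (σ i) - q (σ j)) > 0`. -/
theorem SortedBy.eventually_strictMono {q x : Fin n → ℝ} {σ : Equiv.Perm (Fin n)}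
    (h : SortedBy q σ x) : ∀ᶠ ε : ℝ in 𝓝[>] 0, StrictMono ((x + ε • (x - q)) ∘ σ) := by
  refine eventually_all.2 fun i => eventually_all.2 fun j => ?_
  by_cases hij : i < j
  · rcases h i j hij with h | ⟨h1, h2⟩
    · have hc (i : Fin n) :
          Tendsto (fun ε : ℝ => (x + ε • (x - q)) (σ i)) (𝓝[>] 0) (𝓝 (x (σ i))) := by
        have : Continuous fun ε : ℝ => x (σ i) + ε * (x (σ i) - q (σ i)) := by fun_prop
        simpa using (this.tendsto 0).mono_left nhdsWithin_le_nhds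
      filter_upwards [(hc i).eventually_lt (hc j) h] with ε hε _
      exact hε
    · filter_upwards [self_mem_nhdsWithin] with ε hε _
      have hε : (0 : ℝ) < ε := hε
      simp only [Function.comp_apply, Pi.add_apply, Pi.smul_apply, Pi.sub_apply, smul_eq_mul, h1]
      nlinarith
  · exact Eventually.of_forall fun _ h => absurd h hij

theorem eventually_mem_cube {q x : Fin n → ℝ} (hx : ∀ i, 0 < x i ∧ x i < 1) :
    ∀ᶠ ε : ℝ in 𝓝[>] 0, ∀ i, 0 < (x + ε • (x - q)) i ∧ (x + ε • (x - q)) i < 1 := by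
  refine eventually_all.2 fun i => ?_
  have hc : Tendsto (fun ε : ℝ => (x + ε • (x - q)) i) (𝓝[>] 0) (𝓝 (x i)) := by
    have : Continuous fun ε : ℝ => x i + ε * (x i - q i) := by fun_prop
    simpa using (this.tendsto 0).mono_left nhdsWithin_le_nhds
  exact (hc.eventually_const_lt (hx i).1).and (hc.eventually_lt_const (hx i).2)

/-- The pushed point has the same membership as `x`, stays in the cube, and is strictly ordered by
`σ`; all points so ordered satisfy the same inequalities of `C`. -/
theorem mem_cellPolytope_iff_of_sortedBy {C : List (Ineq n)} {q x : Fin n → ℝ}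
    {σ : Equiv.Perm (Fin n)} (hq : BreaksTies q (cellPolytope C))
    (hx : ∀ i, 0 < x i ∧ x i < 1) (hσ : SortedBy q σ x) :
    x ∈ cellPolytope C ↔ ∃ y ∈ cellPolytope C, StrictMono (y ∘ σ) := by
  obtain ⟨ε, h1, h2, h3⟩ := ((hq x).and
    (hσ.eventually_strictMono.and (eventually_mem_cube (q := q) hx))).exists
  rw [h1]
  constructor
  · exact fun h => ⟨_, h, h2⟩
  · rintro ⟨y, hy, hyσ⟩
    exact ⟨fun I hI => (I.holds_iff_of_strictMono h2 hyσ).2 (hy.1 I hI), h3⟩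

/-! ### Decomposing solution sets into compatible functions -/

open scoped Classical in
/-- In the open unit cube, the solutions of `p` can be counted, together with any symmetric
condition, by functions that are compatible with compositions. -/
def Decomposable (p : (Fin n → ℝ) → Prop) : Prop :=
  ∃ c : Composition n → ℕ, ∀ (ω : Type) [LinearOrder ω] (e : ω → ℝ), StrictMono e →
    (∀ a, 0 < e a ∧ e a < 1) → ∀ s : Finset (Fin n → ω),
    (∀ a ∈ s, ∀ σ : Equiv.Perm (Fin n), a ∘ σ ∈ s) →
    #{a ∈ s | p (e ∘ a)} = ∑ γ, c γ * #{b ∈ s | γ.Compatible b}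

theorem Decomposable.congr {p p' : (Fin n → ℝ) → Prop} (h : Decomposable p)
    (hpp : ∀ x, (∀ i, 0 < x i ∧ x i < 1) → (p' x ↔ p x)) : Decomposable p' := by
  classical
  obtain ⟨c, hc⟩ := h
  refine ⟨c, fun ω _ e he h01 s hs => ?_⟩
  rw [← hc ω e he h01 s hs]
  exact congrArg _ (Finset.filter_congr fun a _ => hpp _ fun i => h01 (a i))

theorem decomposable_false : Decomposable fun _ : Fin n → ℝ => False :=
  ⟨0, fun _ _ _ _ _ _ _ => by simp⟩

theorem Decomposable.or {p p' : (Fin n → ℝ) → Prop} (h : Decomposable p) (h' : Decomposable p')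
    (hd : ∀ x, p x → ¬ p' x) : Decomposable fun x => p x ∨ p' x := by
  classical
  obtain ⟨c, hc⟩ := h
  obtain ⟨c', hc'⟩ := h'
  refine ⟨c + c', fun ω _ e he h01 s hs => ?_⟩
  simp only
  rw [Finset.filter_or, Finset.card_union_of_disjoint
    (Finset.disjoint_filter.2 fun a _ => hd (e ∘ a)), hc ω e he h01 s hs, hc' ω e he h01 s hs,
    ← Finset.sum_add_distrib]
  exact Finset.sum_congr rfl fun _ _ => (add_mul _ _ _).symm

theorem decomposable_exists {ι : Type*} {T : ι → (Fin n → ℝ) → Prop} (s : Finset ι)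
    (hT : ∀ i ∈ s, Decomposable (T i)) (hd : ∀ x i j, T i x → T j x → i = j) :
    Decomposable fun x => ∃ i ∈ s, T i x := by
  classical
  induction s using Finset.induction_on with
  | empty => simpa using decomposable_false
  | insert i s hi ih =>
    simp only [Finset.exists_mem_insert]
    refine (hT i (Finset.mem_insert_self i s)).or
      (ih fun j hj => hT j (Finset.mem_insert_of_mem hj)) ?_
    rintro x hx ⟨j, hj, hxj⟩
    exact hi (hd x i j hx hxj ▸ hj)

theorem decomposable_mem_cellPolytope {C : List (Ineq n)} {q : Fin n → ℝ}
    (hq : Function.Injective q) (hC : BreaksTies q (cellPolytope C)) :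
    Decomposable fun x => x ∈ cellPolytope C := by
  classical
  choose comp hcomp using exists_compatible_iff_sortedBy q
  let J : Finset (Equiv.Perm (Fin n)) := {σ | ∃ y ∈ cellPolytope C, StrictMono (y ∘ σ)}
  -- `J` and `comp` depend only on the cell and `q`, so the coefficients serve every `ω`.
  refine ⟨fun γ => #{σ ∈ J | comp σ = γ}, fun ω _ e he h01 s hs => ?_⟩
  have hmem (a : Fin n → ω) (σ) (hσ : SortedBy q σ a) : e ∘ a ∈ cellPolytope C ↔ σ ∈ J := by
    rw [mem_cellPolytope_iff_of_sortedBy (x := e ∘ a) hC (fun i => h01 (a i))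
      ((sortedBy_comp_iff he q σ a).2 hσ)]
    simp [J]
  have h1 : {a ∈ s | e ∘ a ∈ cellPolytope C} = J.biUnion fun σ => {a ∈ s | SortedBy q σ a} := by
    ext a
    simp only [Finset.mem_filter, Finset.mem_biUnion]
    constructor
    · rintro ⟨ha, hP⟩
      obtain ⟨σ, hσ, -⟩ := existsUnique_sortedBy hq a
      exact ⟨σ, (hmem a σ hσ).1 hP, ha, hσ⟩
    · rintro ⟨σ, hσJ, ha, hσ⟩
      exact ⟨ha, (hmem a σ hσ).2 hσJ⟩
  have h2 (σ) : #{a ∈ s | SortedBy q σ a} = #{b ∈ s | (comp σ).Compatible b} := by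
    refine Finset.card_bij' (fun a _ => a ∘ σ) (fun b _ => b ∘ σ.symm) ?_ ?_ ?_ ?_
    · intro a ha
      rw [Finset.mem_filter] at ha ⊢
      exact ⟨hs a ha.1 σ, (hcomp σ ω a).1 ha.2⟩
    · intro b hb
      rw [Finset.mem_filter] at hb ⊢
      refine ⟨hs b hb.1 σ.symm, (hcomp σ ω _).2 ?_⟩
      rw [Function.comp_assoc, Equiv.symm_comp_self]
      exact hb.2
    · intro a _
      rw [Function.comp_assoc, Equiv.self_comp_symm, Function.comp_id]
    · intro b _
      rw [Function.comp_assoc, Equiv.symm_comp_self, Function.comp_id]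
  rw [h1, Finset.card_biUnion]
  · rw [Finset.sum_congr rfl fun σ _ => h2 σ,
      ← Finset.sum_fiberwise_of_maps_to (g := comp) (t := Finset.univ) fun _ _ => mem_univ _]
    refine Finset.sum_congr rfl fun γ _ => ?_
    rw [Finset.sum_congr rfl fun σ hσ => by rw [(Finset.mem_filter.1 hσ).2],
      Finset.sum_const, smul_eq_mul]
  · intro σ _ τ _ hne
    exact Finset.disjoint_filter.2 fun a _ hσ hτ =>
      hne ((existsUnique_sortedBy hq a).unique hσ hτ)

theorem Ineq.neg_holds_iff (I : Ineq n) (x : Fin n → ℝ) : I.neg.Holds x ↔ ¬ I.Holds x := by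
  cases I <;> simp [Ineq.neg, Ineq.Holds]

/-- `Γ` collects the conditions on the path from the root; the two branches of a node are disjoint,
so their decompositions add. -/
theorem DecisionTree.decomposable (T : DecisionTree n) (Γ : List (Ineq n))
    (h : ∀ C ∈ T.cells, Decomposable fun x => x ∈ cellPolytope (Γ ++ C)) :
    Decomposable fun x => (∀ I ∈ Γ, I.Holds x) ∧ T.Holds x := by
  induction T generalizing Γ with
  | leaf ψ =>
    refine (h ψ (by simp [DecisionTree.cells])).congr fun x hx => ?_
    simp [cellPolytope, hx, DecisionTree.Holds, or_imp, forall_and]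
  | ite φ t f iht ihf =>
    have ht := iht (Γ ++ [φ]) fun C hC => by
      simpa using h (φ :: C) (by simp [DecisionTree.cells, hC])
    have hf := ihf (Γ ++ [φ.neg]) fun C hC => by
      simpa using h (φ.neg :: C) (by simp [DecisionTree.cells, hC])
    refine (ht.or hf ?_).congr fun x _ => ?_
    · rintro x ⟨h1, -⟩ ⟨h2, -⟩
      exact (φ.neg_holds_iff x).1 (h2 _ (by simp)) (h1 _ (by simp))
    · by_cases hφ : φ.Holds x <;>
        simp [DecisionTree.Holds, or_imp, forall_and, Ineq.neg_holds_iff, hφ]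

theorem Problem.holds_comp_iff {ω ω' : Type*} [LinearOrder ω] [LinearOrder ω'] {e : ω → ω'}
    (he : StrictMono e) (S : Problem n) (a : Fin n → ω) : S.Holds (e ∘ a) ↔ S.Holds a := by
  induction S with
  | falsum => rfl
  | atom i j => exact he.le_iff_le
  | not S ih => exact not_congr ih
  | and S T ihS ihT => exact and_congr ihS ihT
  | or S T ihS ihT => exact or_congr ihS ihT

/-! ### Specialising the value set -/

theorem schedulingQSym_eq_sum {S : Problem n} {c : Composition n → ℕ}
    (hc : ∀ (ω : Type) [LinearOrder ω] (e : ω → ℝ), StrictMono e →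
      (∀ a, 0 < e a ∧ e a < 1) → ∀ s : Finset (Fin n → ω),
      (∀ a ∈ s, ∀ σ : Equiv.Perm (Fin n), a ∘ σ ∈ s) →
      Nat.card {a // S.Holds a ∧ a ∈ s} = ∑ γ, c γ * Nat.card {b // γ.Compatible b ∧ b ∈ s}) :
    schedulingQSym S = ∑ α, (c α : ℤ) • fundamentalQSym α := by
  have he : StrictMono fun a : ℕ+ => 1 - 1 / ((a : ℝ) + 1) := by
    intro a b hab
    have h : (a : ℝ) < b := by exact_mod_cast hab
    have h0 : (0 : ℝ) < a := by exact_mod_cast a.pos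
    exact sub_lt_sub_left (one_div_lt_one_div_of_lt (by linarith) (by linarith)) 1
  have h01 (a : ℕ+) : 0 < 1 - 1 / ((a : ℝ) + 1) ∧ 1 - 1 / ((a : ℝ) + 1) < 1 := by
    have h0 : (0 : ℝ) < a := by exact_mod_cast a.pos
    constructor
    · rw [sub_pos, div_lt_one (by linarith)]
      linarith
    · exact sub_lt_self _ (by positivity)
  refine MvPowerSeries.ext fun m => ?_
  -- The vectors with monomial `m` are closed under permutation because the variables commute.
  let s : Finset (Fin n → ℕ+) := (finite_sum_single_eq (fun _ => 1) (fun _ => one_ne_zero) m).toFinset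
  have hs (a) : a ∈ s ↔ ∑ i, Finsupp.single (a i) 1 = m := by simp [s]
  have key := hc ℕ+ _ he h01 s fun a ha σ => by
    rw [hs] at ha ⊢
    rw [← ha]
    exact Equiv.sum_comp σ fun i => Finsupp.single (a i) 1
  simp only [hs] at key
  rw [map_sum]
  change (Nat.card _ : ℤ) = _
  rw [key, Nat.cast_sum]
  refine Finset.sum_congr rfl fun γ _ => ?_
  rw [map_zsmul]
  change _ = (c γ : ℤ) • fundamentalQSym γ m
  rw [fundamentalQSym_apply, smul_eq_mul, Nat.cast_mul]

theorem count_eq_sum {S : Problem n} {c : Composition n → ℕ}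
    (hc : ∀ (ω : Type) [LinearOrder ω] (e : ω → ℝ), StrictMono e →
      (∀ a, 0 < e a ∧ e a < 1) → ∀ s : Finset (Fin n → ω),
      (∀ a ∈ s, ∀ σ : Equiv.Perm (Fin n), a ∘ σ ∈ s) →
      Nat.card {a // S.Holds a ∧ a ∈ s} = ∑ γ, c γ * Nat.card {b // γ.Compatible b ∧ b ∈ s})
    (k : ℕ) : count S k = ∑ γ, c γ * (k + n - γ.length).choose n := by
  have key := hc (Set.Icc 1 k) (fun a => (a : ℝ) / (k + 1))
    (fun a b hab => by
      have h : (a : ℝ) < b := by exact_mod_cast hab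
      exact div_lt_div_of_pos_right h (by positivity))
    (fun a => by
      have h1 : (1 : ℝ) ≤ a := by exact_mod_cast a.2.1
      have h2 : (a : ℝ) ≤ k := by exact_mod_cast a.2.2
      constructor
      · positivity
      · rw [div_lt_one (by positivity)]
        linarith) Finset.univ (fun _ _ _ => Finset.mem_univ _)
  simp only [Finset.mem_univ, and_true] at key
  simp only [← Composition.card_compatible_Icc]
  exact key

theorem exists_hStarPositive {S : Problem n} {c : Composition n → ℕ}
    (h : ∀ k, count S k = ∑ γ, c γ * (k + n - γ.length).choose n) :
    ∃ p : Polynomial ℚ, IsSchedulingPolynomial S p ∧ HStarPositive n p := by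
  choose P hP using exists_polynomial_eval_eq_choose n
  have hp : IsSchedulingPolynomial S (∑ γ, (c γ : ℚ) • P (n - γ.length)) := fun k => by
    rw [h, Polynomial.eval_finsetSum, Nat.cast_sum]
    refine Finset.sum_congr rfl fun γ _ => ?_
    rw [Polynomial.eval_smul, hP, smul_eq_mul, Nat.cast_mul, Nat.add_sub_assoc γ.length_le]
  let len (γ : Composition n) : Fin (n + 1) := ⟨γ.length, Nat.lt_succ_of_le γ.length_le⟩
  -- The binomial of `γ` depends only on its length, so `h i` collects the compositions of length
  -- `i`.
  refine ⟨_, hp, fun i => ∑ γ with len γ = i, (c γ : ℚ), fun k => ?_,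
    fun i => Finset.sum_nonneg fun _ _ => Nat.cast_nonneg _⟩
  rw [hp k, h, Nat.cast_sum, ← Finset.sum_fiberwise_of_maps_to (g := len) (t := Finset.univ)
    fun _ _ => Finset.mem_univ _]
  refine Finset.sum_congr rfl fun i _ => ?_
  rw [Finset.sum_mul]
  refine Finset.sum_congr rfl fun γ hγ => ?_
  rw [← (Finset.mem_filter.1 hγ).2, Nat.cast_mul]

end Scheduling

theorem mainTheorem8 (n : ℕ) (S : Scheduling.Problem n)
    (m : ℕ) (T : Fin m → Scheduling.DecisionTree n)
    (hunion : ∀ x : Fin n → ℝ, S.Holds x ↔ ∃ i, (T i).Holds x)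
    (hdisjoint : ∀ (x : Fin n → ℝ) (i j : Fin m), (T i).Holds x → (T j).Holds x → i = j)
    (hcells : ∀ i, ∀ C ∈ (T i).cells, (Scheduling.cellPolytope C).Nonempty →
      Scheduling.AlmostOpen (Scheduling.cellPolytope C)) :
    Scheduling.LPositive n (Scheduling.schedulingQSym S) ∧
    ∃ p : Polynomial ℚ, Scheduling.IsSchedulingPolynomial S p ∧
      Scheduling.HStarPositive n p := by
  classical
  have hcell (i) (C) (hC : C ∈ (T i).cells) :
      Scheduling.Decomposable fun x => x ∈ Scheduling.cellPolytope C := by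
    rcases (Scheduling.cellPolytope C).eq_empty_or_nonempty with h | h
    · simpa [h] using Scheduling.decomposable_false
    · obtain ⟨q, hq, hqC⟩ := (hcells i C hC h).exists_breaksTies h
      exact Scheduling.decomposable_mem_cellPolytope hq hqC
  have hS : Scheduling.Decomposable fun x : Fin n → ℝ => S.Holds x := by
    refine (Scheduling.decomposable_exists (T := fun i => (T i).Holds) Finset.univ
      (fun i _ => ?_) hdisjoint).congr fun x _ => by simpa using hunion x
    simpa using (T i).decomposable [] (hcell i)
  obtain ⟨c, hc⟩ := hS
  have hc' (ω : Type) [LinearOrder ω] (e : ω → ℝ) (he : StrictMono e)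
      (h01 : ∀ a, 0 < e a ∧ e a < 1) (s : Finset (Fin n → ω))
      (hs : ∀ a ∈ s, ∀ σ : Equiv.Perm (Fin n), a ∘ σ ∈ s) :
      Nat.card {a // S.Holds a ∧ a ∈ s} =
        ∑ γ, c γ * Nat.card {b // γ.Compatible b ∧ b ∈ s} := by
    have h (p : (Fin n → ω) → Prop) : Nat.card {a // p a ∧ a ∈ s} = #{a ∈ s | p a} :=
      Nat.subtype_card _ fun a => by rw [Finset.mem_filter, and_comm]
    simp only [h, ← hc ω e he h01 s hs, S.holds_comp_iff he]
  exact ⟨⟨fun α => c α, fun α => Int.natCast_nonneg _, Scheduling.schedulingQSym_eq_sum hc'⟩,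
    Scheduling.exists_hStarPositive (Scheduling.count_eq_sum hc')⟩
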